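/- \textbf{Setting.} Let $F$ be a fixed, known cumulative distribution function on $\mathbb R$ with $F(x)=1-F(-x)$ for all $x$, three times differentiable, and put $\mu=F$. Fix an integer $T\ge 1$ and let $p_n\in(0,1]$. For each $n$ there are $n+1$ subjects $0,\dots,n$ with true merits $\beta^*=(\beta^*_0,\dots,\beta^*_n)\in\mathbb R^{n+1}$ (depending on $n$), $\beta_0^*=0$. For $i<j$ the number $t_{ij}$ of comparisons of $i$ with $j$ is $\mathrm{Bin}(T,p_n)$, conditionally on $t_{ij}$ the number $a_{ij}$ of wins of $i$ over $j$ is $\mathrm{Bin}(t_{ij},F(\beta_i^*-\beta_j^*))$, and the pairs $(t_{ij},a_{ij})$, $i<j$, are independent; moreover $t_{ji}=t_{ij}$, $a_{ji}=t_{ij}-a_{ij}$, $t_{ii}=a_{ii}=0$. Let $a_i=\sum_{j}a_{ij}$. A moment estimator $\widehat\beta$ is any solution, with $\widehat\beta_0=0$, of $$a_i=\sum_{j\ne i}t_{ij}\,\mu(\widehat\beta_i-\widehat\beta_j),\qquad i=1,\dots,n.$$ \textbf{Assumptions.} Let $\epsilon_n,b_{n0},b_{n1},b_{n2}>0$ be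 such that for every $n$, every $\beta$ with $\beta_0=0$ and $\|\beta-\beta^*\|_\infty\le\epsilon_n$, with $\pi_{ij}=\beta_i-\beta_j$ and the minima and maxima taken over $i\ne j$, $$\Big[\min_{i,j}\mu'(\pi_{ij})\Big]\Big[\max_{i,j}\mu'(\pi_{ij})\Big]>0,\qquad b_{n0}\le\min_{i,j}|\mu'(\pi_{ij})|\le\max_{i,j}|\mu'(\pi_{ij})|\le b_{n1},\qquad \max_{i,j}|\mu''(\pi_{ij})|\le b_{n2}.$$ Put $r_n=\dfrac{b_{n1}^2}{b_{n0}^3p_n^2}\sqrt{\dfrac{\log n}{n}}$ and assume that $r_n=o(\epsilon_n)$. \textbf{Theorem (consistency).} If $b_{n1}^4b_{n2}/(b_{n0}^6p_n^4)=o\big((n/\log n)^{1/2}\big)$ as $n\to\infty$, then a moment estimator exists with probability tending to one, and every choice $\widehat\beta$ of a moment estimator (arbitrary where none exists) satisfies $$\|\widehat\beta-\beta^*\|_\infty=O_p\!\left(\frac{b_{n1}^2}{b_{n0}^3p_n^2}\sqrt{\frac{\log n}{n}}\right)\qquad\text{and}\qquad \|\widehat\beta-\beta^*\|_\infty=o_p(1).$$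 -/

import Mathlib

open MeasureTheory ProbabilityTheory Filter Topology Asymptotics

namespace PairedComparison

/-- The weight `P(X = k)` of a binomial variable `X` with `N` trials and success probability `x`
(it vanishes for `k > N`, because then the binomial coefficient does). -/
def binomialWeight (N : ℕ) (x : ℝ) (k : ℕ) : ℝ :=
  (N.choose k : ℝ) * x ^ k * (1 - x) ^ (N - k)

/-- The random arrays `t i j` (number of comparisons of `i` with `j`) and `a i j` (number of wins
of `i` over `j`) on `(Ω, P)` follow the paired comparison model with subjects `0, …, n`, merits
`β`, winning probability function `F` and an Erdős–Rényi comparison graph: for each pair `i < j`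
the number of comparisons is binomial `(T, p)`, given it the number of wins of `i` over `j` is
binomial `(t i j, F (β i - β j))`, and different pairs are independent. -/
structure IsModel {Ω : Type*} [MeasurableSpace Ω] (P : Measure Ω) (F : ℝ → ℝ) {n : ℕ}
    (β : Fin (n + 1) → ℝ) (T : ℕ) (p : ℝ) (t a : Fin (n + 1) → Fin (n + 1) → Ω → ℕ) : Prop where
  measurable_t : ∀ i j, Measurable (t i j)
  measurable_a : ∀ i j, Measurable (a i j)
  t_diag : ∀ i w, t i i w = 0
  a_diag : ∀ i w, a i i w = 0
  t_symm : ∀ i j w, t i j w = t j i w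
  a_add : ∀ i j w, a i j w + a j i w = t i j w
  law : ∀ i j, i < j → ∀ m k : ℕ,
    P.real {w | t i j w = m ∧ a i j w = k} =
      binomialWeight T p m * binomialWeight m (F (β i - β j)) k
  indep : iIndepFun
    (fun (e : {e : Fin (n + 1) × Fin (n + 1) // e.1 < e.2}) (w : Ω) =>
      (t e.1.1 e.1.2 w, a e.1.1 e.1.2 w)) P

/-- `b` solves the moment equations `a_i = ∑_j t_ij μ(b_i - b_j)`, `i = 1, …, n`, where
`a_i = ∑_j a_ij`, under the normalization `b_0 = 0`; here `t`, `a` are observed arrays. -/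
def IsMomentEstimator (μ : ℝ → ℝ) {n : ℕ} (t a : Fin (n + 1) → Fin (n + 1) → ℕ)
    (b : Fin (n + 1) → ℝ) : Prop :=
  b 0 = 0 ∧ ∀ i : Fin (n + 1), i ≠ 0 →
    ((∑ j, a i j : ℕ) : ℝ) = ∑ j, (t i j : ℝ) * μ (b i - b j)

/-- The bounds on the derivatives of `μ` in the `ε`-neighbourhood of `β` (the `0`-th coordinate
being fixed to `0`): all `μ'(π_ij)`, `i ≠ j`, have the same sign, `b0 ≤ |μ'(π_ij)| ≤ b1` and
`|μ''(π_ij)| ≤ b2`, where `π_ij = b_i - b_j`. -/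
structure DerivBounds (μ : ℝ → ℝ) {n : ℕ} (β : Fin (n + 1) → ℝ) (ε b0 b1 b2 : ℝ) : Prop where
  sign : ∀ b : Fin (n + 1) → ℝ, b 0 = 0 → (∀ i, |b i - β i| ≤ ε) →
    ∀ i j k l, i ≠ j → k ≠ l → 0 < deriv μ (b i - b j) * deriv μ (b k - b l)
  first : ∀ b : Fin (n + 1) → ℝ, b 0 = 0 → (∀ i, |b i - β i| ≤ ε) →
    ∀ i j, i ≠ j → b0 ≤ |deriv μ (b i - b j)| ∧ |deriv μ (b i - b j)| ≤ b1
  second : ∀ b : Fin (n + 1) → ℝ, b 0 = 0 → (∀ i, |b i - β i| ≤ ε) →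
    ∀ i j, i ≠ j → |deriv (deriv μ) (b i - b j)| ≤ b2

/-- `X_n = O_p(r_n)`. -/
def IsBigOp {Ω : ℕ → Type*} [∀ n, MeasurableSpace (Ω n)] (P : ∀ n, Measure (Ω n))
    (X : ∀ n, Ω n → ℝ) (r : ℕ → ℝ) : Prop :=
  ∀ δ : ℝ, 0 < δ → ∃ M : ℝ, 0 < M ∧
    ∀ᶠ n in atTop, (P n).real {w | M * r n < |X n w|} ≤ δ

/-- `X_n = o_p(1)`. -/
def IsLittleOpOne {Ω : ℕ → Type*} [∀ n, MeasurableSpace (Ω n)] (P : ∀ n, Measure (Ω n))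
    (X : ∀ n, Ω n → ℝ) : Prop :=
  ∀ δ : ℝ, 0 < δ → Tendsto (fun n => (P n).real {w | δ < |X n w|}) atTop (𝓝 0)

/-- The rate `b1² / (b0³ p²) · √(log n / n)`. -/
noncomputable def rate (b0 b1 p : ℕ → ℝ) (n : ℕ) : ℝ :=
  b1 n ^ 2 / (b0 n ^ 3 * p n ^ 2) * √(Real.log n / n)

end PairedComparison

/-! Fix the data and put d = b - β. As F is increasing, at an index i maximising d all terms of
residual(β) - residual(b) are nonnegative, and every opponent j of i contributes at least b0·min(d_i
- d_j, ε). The mirror statement holds at an index k minimising d. A common neighbour j of i and k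
enters both sums, and (d_i - d_j) + (d_j - d_k) is the whole oscillation of d. Hence b0·min(osc d,
ε)·#(common neighbours) is at most twice the largest residual at β, provided the residuals at b have
the right signs at i and k (`IsTally.osc_mul_card_le`).

For a solution these residuals vanish, and d_0 = 0 turns the oscillation into a bound on the norm
(`IsMomentEstimator.norm_sub_le`). For existence, minimise over the ε-box around β an energy with
gradient -2·residual. One-sided optimality gives the signs, so osc d < ε, and a translate of the
minimiser lies in the open box and is critical.

Two Hoeffding bounds show that, outside an event of probability 8/n, the residuals at β are at most
2T√(n log n) and any two subjects have at least np²/4 common neighbours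
(`IsModel.prob_not_isRegular_le`). The quotient is 16T√(log n/n)/(b0 p²), at most 16T times the rate
because b0 ≤ b1. The second bound needs log n ≤ np⁴/16. This and rate → 0 follow from the hypotheses
because F has total mass one: some two merits must be close relative to ε, so the derivative bounds
apply at 0 and, when ε is large, at a fixed point where F'' ≠ 0. -/

namespace PairedComparison

/-! ### Deterministic part: maximum principle, existence and error bound for given data. -/

section Deterministic

variable {n : ℕ}

/-- The residual of the `i`-th moment equation at `b`. -/
def residual (F : ℝ → ℝ) (t a : Fin (n + 1) → Fin (n + 1) → ℕ) (b : Fin (n + 1) → ℝ)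
    (i : Fin (n + 1)) : ℝ :=
  ∑ j, ((a i j : ℝ) - t i j * F (b i - b j))

/-- The deterministic properties of the arrays of comparisons and wins. -/
structure IsTally (t a : Fin (n + 1) → Fin (n + 1) → ℕ) : Prop where
  diag : ∀ i, t i i = 0
  symm : ∀ i j, t i j = t j i
  add : ∀ i j, a i j + a j i = t i j

/-- The common neighbours of `i` and `k` in the comparison graph. -/
def commonNeighbors (t : Fin (n + 1) → Fin (n + 1) → ℕ) (i k : Fin (n + 1)) :
    Finset (Fin (n + 1)) :=
  {j | 1 ≤ t i j ∧ 1 ≤ t k j}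

/-- The increments of `F` away from each `β i - β j` grow at least linearly up to distance `ε`. -/
def GrowsAt (F : ℝ → ℝ) (β : Fin (n + 1) → ℝ) (ε c : ℝ) : Prop :=
  ∀ i j, i ≠ j → ∀ u, 0 ≤ u → c * min u ε ≤ F (β i - β j + u) - F (β i - β j)

variable {F : ℝ → ℝ} {t a : Fin (n + 1) → Fin (n + 1) → ℕ} {β b : Fin (n + 1) → ℝ} {ε c H : ℝ}

lemma isMomentEstimator_iff_residual :
    IsMomentEstimator F t a b ↔ b 0 = 0 ∧ ∀ i, i ≠ 0 → residual F t a b i = 0 := by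
  simp only [IsMomentEstimator, residual, Finset.sum_sub_distrib, sub_eq_zero, Nat.cast_sum]

lemma IsTally.residual_term_antisymm (h : IsTally t a) (hF : ∀ x, F x = 1 - F (-x))
    (b : Fin (n + 1) → ℝ) (i j : Fin (n + 1)) :
    (a i j : ℝ) - t i j * F (b i - b j) = -((a j i : ℝ) - t j i * F (b j - b i)) := by
  have h1 : (a i j : ℝ) + a j i = t i j := by exact_mod_cast h.add i j
  have h2 := hF (b i - b j)
  rw [neg_sub] at h2
  rw [h2, h.symm j i]
  linarith

/-- The two terms of each pair cancel. This recovers the equation of subject 0, which the estimator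
does not impose. -/
lemma IsTally.sum_residual (h : IsTally t a) (hF : ∀ x, F x = 1 - F (-x))
    (b : Fin (n + 1) → ℝ) : ∑ i, residual F t a b i = 0 := by
  have h1 : ∑ i, residual F t a b i = -∑ i, residual F t a b i := by
    conv_rhs => simp only [residual]; rw [Finset.sum_comm]
    simp only [residual, ← Finset.sum_neg_distrib]
    exact Finset.sum_congr rfl fun i _ => Finset.sum_congr rfl fun j _ =>
      h.residual_term_antisymm hF b i j
  linarith

lemma IsMomentEstimator.residual_eq_zero (hb : IsMomentEstimator F t a b) (h : IsTally t a)
    (hF : ∀ x, F x = 1 - F (-x)) (i : Fin (n + 1)) : residual F t a b i = 0 := by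
  rw [isMomentEstimator_iff_residual] at hb
  by_cases hi : i = 0
  · have h1 := h.sum_residual hF b
    rw [Finset.sum_eq_single 0 (fun j _ hj => hb.2 j hj) (by simp)] at h1
    rw [hi, h1]
  · exact hb.2 i hi

lemma min_add_min_ge {u v ε : ℝ} (hu : 0 ≤ u) (hv : 0 ≤ v) (hε : 0 ≤ ε) :
    min (u + v) ε ≤ min u ε + min v ε := by
  rcases le_total u ε with h1 | h1 <;> rcases le_total v ε with h2 | h2 <;>
    simp only [min_eq_left, min_eq_right, h1, h2, min_le_iff]
  · exact .inl le_rfl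
  · exact .inr (by linarith)
  · exact .inr (by linarith)
  · exact .inr (by linarith)

/-- At a maximum of `b - β` the residual decreases by at least the weighted sum of increments over
any set of neighbours. -/
lemma IsTally.sum_le_of_max (h : IsTally t a) (hc : 0 ≤ c) (hε : 0 ≤ ε)
    (hg : GrowsAt F β ε c) {i : Fin (n + 1)} (hi : ∀ j, b j - β j ≤ b i - β i)
    (S : Finset (Fin (n + 1))) (hS : ∀ j ∈ S, 1 ≤ t i j) :
    ∑ j ∈ S, c * min ((b i - β i) - (b j - β j)) ε
      ≤ residual F t a β i - residual F t a b i := by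
  have key : ∀ j, j ≠ i → c * min ((b i - β i) - (b j - β j)) ε
      ≤ F (b i - b j) - F (β i - β j) := fun j hj => by
    have := hg i j hj.symm ((b i - β i) - (b j - β j)) (by linarith [hi j])
    rwa [show β i - β j + ((b i - β i) - (b j - β j)) = b i - b j by ring] at this
  have h0 : ∀ j, 0 ≤ c * min ((b i - β i) - (b j - β j)) ε := fun j =>
    mul_nonneg hc (le_min (by linarith [hi j]) hε)
  have e : residual F t a β i - residual F t a b i
      = ∑ j, (t i j : ℝ) * (F (b i - b j) - F (β i - β j)) := by
    simp only [residual, ← Finset.sum_sub_distrib]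
    exact Finset.sum_congr rfl fun j _ => by ring
  have hnn : ∀ j, 0 ≤ (t i j : ℝ) * (F (b i - b j) - F (β i - β j)) := fun j => by
    by_cases hj : j = i
    · simp [hj, h.diag]
    · exact mul_nonneg (Nat.cast_nonneg _) ((h0 j).trans (key j hj))
  rw [e]
  refine (Finset.sum_le_sum fun j hj => ?_).trans
    (Finset.sum_le_sum_of_subset_of_nonneg (Finset.subset_univ S) fun j _ _ => hnn j)
  have hji : j ≠ i := by
    rintro rfl
    have := hS j hj
    rw [h.diag] at this
    omega
  have h1 : (1 : ℝ) ≤ t i j := by exact_mod_cast hS j hj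
  have h2 := key j hji
  have h3 := h0 j
  nlinarith

/-- Reversing all signs exchanges wins and losses. -/
lemma IsTally.swap (h : IsTally t a) : IsTally t (fun i j => a j i) :=
  ⟨h.diag, h.symm, fun i j => by rw [Nat.add_comm]; exact h.add i j⟩

lemma IsTally.residual_neg (h : IsTally t a) (hF : ∀ x, F x = 1 - F (-x))
    (b : Fin (n + 1) → ℝ) (i : Fin (n + 1)) :
    residual F t (fun i j => a j i) (-b) i = -residual F t a b i := by
  simp only [residual, ← Finset.sum_neg_distrib, Pi.neg_apply]
  refine Finset.sum_congr rfl fun j _ => ?_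
  rw [h.residual_term_antisymm hF b i j, neg_neg, h.symm i j,
    show -b i - -b j = b j - b i by ring]

lemma GrowsAt.neg (hg : GrowsAt F β ε c) : GrowsAt F (-β) ε c := fun i j hij u hu => by
  have := hg j i hij.symm u hu
  rwa [show β j - β i = (-β) i - (-β) j by simp; ring] at this

/-- The maximum principle: the oscillation of `b - β` is controlled by the residual at `β`, as soon
as the residual at `b` has the right sign at the maximum and at the minimum of `b - β`. -/
lemma IsTally.osc_mul_card_le (h : IsTally t a) (hF : ∀ x, F x = 1 - F (-x)) (hc : 0 ≤ c)
    (hε : 0 ≤ ε) (hg : GrowsAt F β ε c) (hH : ∀ i, |residual F t a β i| ≤ H)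
    {i k : Fin (n + 1)} (hi : ∀ j, b j - β j ≤ b i - β i) (hk : ∀ j, b k - β k ≤ b j - β j)
    (ri : 0 ≤ residual F t a b i) (rk : residual F t a b k ≤ 0) :
    c * min ((b i - β i) - (b k - β k)) ε * (commonNeighbors t i k).card ≤ 2 * H := by
  have h1 := h.sum_le_of_max hc hε hg hi (commonNeighbors t i k)
    (fun j hj => by simp only [commonNeighbors, Finset.mem_filter] at hj; exact hj.2.1)
  have h2 := h.swap.sum_le_of_max hc hε hg.neg (b := -b) (i := k)
    (fun j => by simp only [Pi.neg_apply]; linarith [hk j]) (commonNeighbors t i k)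
    (fun j hj => by simp only [commonNeighbors, Finset.mem_filter] at hj; exact hj.2.2)
  rw [h.residual_neg hF, h.residual_neg hF] at h2
  have h3 := (abs_le.1 (hH i)).2
  have h4 := (abs_le.1 (hH k)).1
  -- Split the oscillation at the common neighbour j; truncation at ε is subadditive.
  have h5 : ∑ j ∈ commonNeighbors t i k, c * min ((b i - β i) - (b k - β k)) ε ≤
      ∑ j ∈ commonNeighbors t i k, c * min ((b i - β i) - (b j - β j)) ε +
      ∑ j ∈ commonNeighbors t i k, c * min (((-b) k - (-β) k) - ((-b) j - (-β) j)) ε := by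
    rw [← Finset.sum_add_distrib]
    refine Finset.sum_le_sum fun j _ => ?_
    rw [← mul_add]
    refine mul_le_mul_of_nonneg_left ?_ hc
    refine le_trans (le_of_eq ?_) (min_add_min_ge (by linarith [hi j])
      (by simp only [Pi.neg_apply]; linarith [hk j]) hε)
    simp only [Pi.neg_apply]
    congr 1
    ring
  rw [Finset.sum_const, nsmul_eq_mul] at h5
  linarith

/-- The potential whose critical points solve the moment equations; `Φ` is a primitive of `F`. -/
def energy (Φ : ℝ → ℝ) (t a : Fin (n + 1) → Fin (n + 1) → ℕ) (b : Fin (n + 1) → ℝ) : ℝ :=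
  ∑ k, ∑ j, ((t k j : ℝ) * Φ (b k - b j) - a k j * (b k - b j))

lemma energy_add_const (Φ : ℝ → ℝ) (t a : Fin (n + 1) → Fin (n + 1) → ℕ)
    (b : Fin (n + 1) → ℝ) (s : ℝ) : energy Φ t a (fun i => b i + s) = energy Φ t a b := by
  simp [energy]

lemma continuous_energy {Φ : ℝ → ℝ} (hΦ : Continuous Φ) (t a : Fin (n + 1) → Fin (n + 1) → ℕ) :
    Continuous (energy Φ t a) := by
  unfold energy
  fun_prop

/-- Each unordered pair occurs twice in the double sum, and by antisymmetry both occurrences have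
the same derivative; hence the factor 2. -/
lemma IsTally.hasDerivAt_energy {Φ : ℝ → ℝ} (h : IsTally t a) (hF : ∀ x, F x = 1 - F (-x))
    (hΦ : ∀ x, HasDerivAt Φ (F x) x) (b : Fin (n + 1) → ℝ) (i : Fin (n + 1)) :
    HasDerivAt (fun s : ℝ => energy Φ t a (b + s • Pi.single i 1))
      (-2 * residual F t a b i) 0 := by
  let e : Fin (n + 1) → ℝ := Pi.single i 1
  have h1 : ∀ k j, HasDerivAt (fun s : ℝ => (b + s • e) k - (b + s • e) j) (e k - e j) 0 := by
    intro k j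
    simp only [Pi.add_apply, Pi.smul_apply, smul_eq_mul]
    have h2 : ∀ k, HasDerivAt (fun s : ℝ => b k + s * e k) (e k) 0 := fun k => by
      simpa using ((hasDerivAt_id (0 : ℝ)).mul_const (e k)).const_add (b k)
    exact (h2 k).sub (h2 j)
  have h3 : HasDerivAt (fun s : ℝ => energy Φ t a (b + s • e))
      (∑ k, ∑ j, ((t k j : ℝ) * (F (b k - b j) * (e k - e j)) - a k j * (e k - e j))) 0 := by
    unfold energy
    refine HasDerivAt.fun_sum fun k _ => HasDerivAt.fun_sum fun j _ => ?_
    refine HasDerivAt.sub (HasDerivAt.const_mul _ ?_) ((h1 k j).const_mul _)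
    have := hΦ ((b + (0 : ℝ) • e) k - (b + (0 : ℝ) • e) j)
    have h4 := this.comp (0 : ℝ) (h1 k j)
    simpa [Function.comp_def] using h4
  convert h3 using 1
  have h5 : ∀ k j, (t k j : ℝ) * (F (b k - b j) * (e k - e j)) - a k j * (e k - e j)
      = -(e k * (a k j - t k j * F (b k - b j))) - e j * (a j k - t j k * F (b j - b k)) := by
    intro k j
    rw [h.residual_term_antisymm hF b j k]
    ring
  have h6 : ∑ k, e k * residual F t a b k = residual F t a b i := by
    simp [e, Pi.single_apply]
  simp only [h5, Finset.sum_sub_distrib]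
  rw [Finset.sum_comm (f := fun k j => e j * (a j k - t j k * F (b j - b k)))]
  simp only [Finset.sum_neg_distrib, ← Finset.mul_sum]
  simp only [residual] at h6 ⊢
  rw [h6]
  ring

/-- One-sided versions are needed because a minimiser over the box may lie on a face. -/
lemma deriv_nonpos_of_le_left {f : ℝ → ℝ} {f' δ : ℝ} (hf : HasDerivAt f f' 0) (hδ : 0 < δ)
    (hmin : ∀ s, -δ ≤ s → s ≤ 0 → f 0 ≤ f s) : f' ≤ 0 := by
  have h1 := hf.hasDerivWithinAt (s := Set.Iio 0)
  rw [hasDerivWithinAt_iff_tendsto_slope' (by simp)] at h1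
  refine le_of_tendsto h1 ?_
  have : Set.Ioo (-δ) 0 ∈ 𝓝[<] (0 : ℝ) := Ioo_mem_nhdsLT (by linarith)
  filter_upwards [this] with s hs
  rw [slope_def_field]
  exact div_nonpos_of_nonneg_of_nonpos (sub_nonneg.2 (hmin s hs.1.le hs.2.le)) (by linarith [hs.2])

lemma deriv_nonneg_of_le_right {f : ℝ → ℝ} {f' δ : ℝ} (hf : HasDerivAt f f' 0) (hδ : 0 < δ)
    (hmin : ∀ s, 0 ≤ s → s ≤ δ → f 0 ≤ f s) : 0 ≤ f' := by
  have h1 : HasDerivAt (fun s => f (-s)) (-f') 0 := by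
    have := HasDerivAt.comp (0 : ℝ) (h₂ := f) (h := fun s => -s) (by simpa using hf)
      (hasDerivAt_neg (0 : ℝ))
    simpa [Function.comp_def] using this
  have := deriv_nonpos_of_le_left h1 hδ (fun s h1 h2 => by
    simpa using hmin (-s) (by linarith) (by linarith))
  linarith

/-- A solution of all moment equations exists if the residual at `β` is small compared with the
number of common neighbours. -/
lemma IsTally.exists_isMomentEstimator {Φ : ℝ → ℝ} (h : IsTally t a)
    (hF : ∀ x, F x = 1 - F (-x)) (hΦ : ∀ x, HasDerivAt Φ (F x) x) (hβ : β 0 = 0) (hc : 0 ≤ c)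
    (hε : 0 < ε) (hg : GrowsAt F β ε c) (hH : ∀ i, |residual F t a β i| ≤ H)
    (hN : ∀ i k, i ≠ k → 2 * H < c * ε * (commonNeighbors t i k).card) :
    ∃ b, IsMomentEstimator F t a b := by
  have hcont : Continuous (energy Φ t a) :=
    continuous_energy (continuous_iff_continuousAt.2 fun x => (hΦ x).continuousAt) t a
  obtain ⟨b, hb, hmin⟩ := (isCompact_closedBall β ε).exists_isMinOn
    ⟨β, Metric.mem_closedBall_self hε.le⟩ hcont.continuousOn
  have hball : ∀ b : Fin (n + 1) → ℝ, b ∈ Metric.closedBall β ε ↔ ∀ i, |b i - β i| ≤ ε := by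
    intro b
    rw [Metric.mem_closedBall, dist_pi_le_iff hε.le]
    simp [Real.dist_eq]
  have hbi := (hball b).1 hb
  have hmem : ∀ (b : Fin (n + 1) → ℝ) (i : Fin (n + 1)) (s : ℝ), (∀ j, |b j - β j| ≤ ε) →
      |b i + s - β i| ≤ ε → b + s • Pi.single i 1 ∈ Metric.closedBall β ε := by
    intro b i s h1 h2
    rw [hball]
    intro j
    by_cases hj : j = i
    · subst hj; simpa using h2
    · simpa [hj] using h1 j
  -- A coordinate off the lower face can be decreased, one off the upper face increased. This is
  -- stated for any minimiser, to be reused after the translation.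
  have hup : ∀ b : Fin (n + 1) → ℝ, (∀ j, |b j - β j| ≤ ε) →
      (∀ b' ∈ Metric.closedBall β ε, energy Φ t a b ≤ energy Φ t a b') → ∀ i,
      (-ε < b i - β i → 0 ≤ residual F t a b i) ∧ (b i - β i < ε → residual F t a b i ≤ 0) := by
    intro b hbi hmin i
    have hd := h.hasDerivAt_energy hF hΦ b i
    have h0 := abs_le.1 (hbi i)
    constructor
    · intro h1
      have := deriv_nonpos_of_le_left hd (δ := b i - β i + ε) (by linarith) (fun s h1 h2 => by
        simpa using hmin _ (hmem b i s hbi (abs_le.2 ⟨by linarith, by linarith⟩)))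
      linarith
    · intro h1
      have := deriv_nonneg_of_le_right hd (δ := ε - (b i - β i)) (by linarith)
        (fun s h1 h2 => by
          simpa using hmin _ (hmem b i s hbi (abs_le.2 ⟨by linarith, by linarith⟩)))
      linarith
  obtain ⟨i, -, hi⟩ := Finset.exists_max_image Finset.univ (fun j => b j - β j) ⟨0, by simp⟩
  obtain ⟨k, -, hk⟩ := Finset.exists_min_image Finset.univ (fun j => b j - β j) ⟨0, by simp⟩
  simp only [Finset.mem_univ, true_implies] at hi hk
  have hosc : (b i - β i) - (b k - β k) < ε := by
    by_contra hcon
    push Not at hcon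
    have hik : i ≠ k := by rintro rfl; linarith
    -- An oscillation of at least ε keeps the maximum off the lower face and the minimum off the
    -- upper one.
    have h1 := h.osc_mul_card_le hF hc hε.le hg hH hi hk
      ((hup b hbi hmin i).1 (by linarith [(abs_le.1 (hbi k)).1]))
      ((hup b hbi hmin k).2 (by linarith [(abs_le.1 (hbi i)).2]))
    rw [min_eq_right hcon] at h1
    linarith [hN i k hik]
  -- As `β 0 = 0`, this is the difference of two values of b - β, hence below the oscillation: the
  -- translate is interior, and its energy is still minimal.
  have hlt : ∀ j, |b j + -b 0 - β j| < ε := fun j =>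
    abs_lt.2 ⟨by linarith [hk j, hi 0], by linarith [hi j, hk 0]⟩
  refine ⟨fun j => b j + -b 0, isMomentEstimator_iff_residual.2 ⟨by simp, fun j _ => ?_⟩⟩
  have h1 := hup (fun j => b j + -b 0) (fun j => (hlt j).le) (fun b' hb' => by
    rw [energy_add_const]
    exact hmin hb') j
  have h2 := abs_lt.1 (hlt j)
  exact le_antisymm (h1.2 h2.2) (h1.1 h2.1)

/-- Every solution of the moment equations is close to `β` if the residual at `β` is small compared
with the number of common neighbours. -/
lemma IsMomentEstimator.norm_sub_le {R : ℝ} (hb : IsMomentEstimator F t a b) (h : IsTally t a)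
    (hF : ∀ x, F x = 1 - F (-x)) (hβ : β 0 = 0) (hc : 0 < c) (hR : 0 ≤ R) (hε : R < ε)
    (hg : GrowsAt F β ε c) (hH : ∀ i, |residual F t a β i| ≤ H)
    (hN : ∀ i k, i ≠ k → 0 < (commonNeighbors t i k).card ∧
      2 * H ≤ c * R * (commonNeighbors t i k).card) :
    ‖b - β‖ ≤ R := by
  obtain ⟨i, -, hi⟩ := Finset.exists_max_image Finset.univ (fun j => b j - β j) ⟨0, by simp⟩
  obtain ⟨k, -, hk⟩ := Finset.exists_min_image Finset.univ (fun j => b j - β j) ⟨0, by simp⟩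
  simp only [Finset.mem_univ, true_implies] at hi hk
  have hosc : (b i - β i) - (b k - β k) ≤ R := by
    by_contra hcon
    push Not at hcon
    have hik : i ≠ k := by rintro rfl; linarith
    have h1 := h.osc_mul_card_le hF hc.le (hR.trans hε.le) hg hH hi hk
      (hb.residual_eq_zero h hF i).ge (hb.residual_eq_zero h hF k).le
    have hpos : (0 : ℝ) < (commonNeighbors t i k).card := by exact_mod_cast (hN i k hik).1
    -- Since R < ε, the truncation does not destroy the strict inequality.
    have h2 : R < min ((b i - β i) - (b k - β k)) ε := lt_min hcon hε
    have h3 := mul_lt_mul_of_pos_right (mul_lt_mul_of_pos_left h2 hc) hpos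
    linarith [(hN i k hik).2]
  have hb0 : b 0 - β 0 = 0 := by rw [hb.1, hβ, sub_zero]
  rw [pi_norm_le_iff_of_nonneg hR]
  intro j
  rw [Pi.sub_apply, Real.norm_eq_abs, abs_le]
  constructor <;> linarith [hi 0, hk 0, hi j, hk j]

end Deterministic

end PairedComparison

namespace PairedComparison

/-! ### The random comparison model: moments, independence, concentration. -/

section Binomial

lemma sum_binomialWeight (N : ℕ) (x : ℝ) :
    ∑ k ∈ Finset.range (N + 1), binomialWeight N x k = 1 := by
  have h := congrArg (Polynomial.eval x) (bernsteinPolynomial.sum ℝ N)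
  simpa [Polynomial.eval_finsetSum, bernsteinPolynomial, binomialWeight] using h

lemma sum_mul_binomialWeight (N : ℕ) (x : ℝ) :
    ∑ k ∈ Finset.range (N + 1), (k : ℝ) * binomialWeight N x k = N * x := by
  have h := congrArg (Polynomial.eval x) (bernsteinPolynomial.sum_smul ℝ N)
  simpa [Polynomial.eval_finsetSum, bernsteinPolynomial, binomialWeight] using h

end Binomial

section Probability

variable {n : ℕ} {Ω : Type*} [MeasurableSpace Ω] {P : Measure Ω}
  {F : ℝ → ℝ} {β : Fin (n + 1) → ℝ} {T : ℕ} {p : ℝ} {t a : Fin (n + 1) → Fin (n + 1) → Ω → ℕ}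

/-- The unordered pair of two different indices, listed in increasing order. -/
def orderedPair (i j : Fin (n + 1)) (h : i ≠ j) :
    {e : Fin (n + 1) × Fin (n + 1) // e.1 < e.2} :=
  if hij : i < j then ⟨(i, j), hij⟩ else ⟨(j, i), lt_of_le_of_ne (not_lt.1 hij) h.symm⟩

lemma orderedPair_eq {i j k l : Fin (n + 1)} {h : i ≠ j} {h' : k ≠ l}
    (e : orderedPair i j h = orderedPair k l h') : (i = k ∧ j = l) ∨ (i = l ∧ j = k) := by
  unfold orderedPair at e
  split_ifs at e <;> simp only [Subtype.mk.injEq, Prod.mk.injEq] at e <;> tauto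

namespace IsModel

lemma isTally (hM : IsModel P F β T p t a) (w : Ω) :
    IsTally (fun i j => t i j w) (fun i j => a i j w) :=
  ⟨fun i => hM.t_diag i w, fun i j => hM.t_symm i j w, fun i j => hM.a_add i j w⟩

lemma iIndepFun_row (hM : IsModel P F β T p t a) (i : Fin (n + 1)) :
    iIndepFun (fun (j : {j // j ≠ i}) (w : Ω) => (t i j w, a i j w)) P := by
  have h1 := hM.indep.precomp (g := fun j : {j // j ≠ i} => orderedPair i j j.2.symm)
    (fun j k e => by
      rcases orderedPair_eq e with h | h
      · exact Subtype.ext h.2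
      · exact absurd h.1.symm k.2)
  -- For j < i the independent family records the wins of j over i; the wins of i are recovered by
  -- subtraction from `t`.
  have h2 := h1.comp (γ := fun _ => ℕ × ℕ)
    (fun j x => if i < j.1 then x else (x.1, x.1 - x.2)) (fun j => measurable_of_countable _)
  convert h2 using 2 with j
  funext w
  by_cases hij : i < j.1
  · simp [orderedPair, hij]
  · have h3 := hM.a_add i j w
    have h4 := hM.t_symm i j w
    simp only [orderedPair, hij, Function.comp, dite_false, if_false, Prod.mk.injEq]
    omega

lemma measurableSet_compared (hM : IsModel P F β T p t a) (i j : Fin (n + 1)) :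
    MeasurableSet {w | 1 ≤ t i j w} :=
  hM.measurable_t i j measurableSet_Ici

/-- The unordered pairs {i, k} and {j, k}, with k outside {i, j}, are all distinct, so their
comparison events are independent and can be grouped by k. -/
lemma iIndepSet_common (hM : IsModel P F β T p t a) {i j : Fin (n + 1)} (hij : i ≠ j) :
    iIndepSet (fun k : {k // k ≠ i ∧ k ≠ j} => {w | 1 ≤ t i k w ∧ 1 ≤ t j k w}) P ∧
    ∀ k : {k // k ≠ i ∧ k ≠ j}, P {w | 1 ≤ t i k w ∧ 1 ≤ t j k w} =
      P {w | 1 ≤ t i k w} * P {w | 1 ≤ t j k w} := by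
  let K := {k : Fin (n + 1) // k ≠ i ∧ k ≠ j}
  let v : Bool → Fin (n + 1) := fun b => bif b then i else j
  have hv : ∀ (k : K) (b : Bool), v b ≠ k := by
    rintro k (_ | _)
    exacts [k.2.2.symm, k.2.1.symm]
  have h1 := hM.indep.precomp (g := fun x : K × Bool => orderedPair (v x.2) x.1 (hv x.1 x.2))
    (fun x y e => by
      rcases orderedPair_eq e with h | h
      · refine Prod.ext (Subtype.ext h.2) ?_
        have h3 := h.1
        rcases hx : x.2 <;> rcases hy : y.2 <;> simp_all [v]
      · exact absurd h.1 (hv _ _))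
  let E : K × Bool → Set Ω := fun x => {w | 1 ≤ t (v x.2) x.1 w}
  have h2 : ∀ S : Finset (K × Bool), P (⋂ x ∈ S, E x) = ∏ x ∈ S, P (E x) := by
    intro S
    refine h1.meas_biInter fun x _ => ⟨{y | 1 ≤ y.1}, MeasurableSet.of_discrete, ?_⟩
    ext w
    have h4 := hM.t_symm (v x.2) x.1 w
    by_cases h3 : v x.2 < x.1
    · simp [E, orderedPair, h3]
    · simp [E, orderedPair, h3, h4]
  have h3 : ∀ S : Finset K, (⋂ k ∈ S, {w | 1 ≤ t i k w ∧ 1 ≤ t j k w})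
      = ⋂ x ∈ S ×ˢ (Finset.univ : Finset Bool), E x := by
    intro S
    ext w
    simp only [Set.mem_iInter, Set.mem_ofPred_eq, Finset.mem_product, Finset.mem_univ, and_true, E,
      Prod.forall, Bool.forall_bool, v, cond_true, cond_false]
    constructor
    · exact fun h k => ⟨fun hk => (h k hk).2, fun hk => (h k hk).1⟩
    · exact fun h k hk => ⟨(h k).2 hk, (h k).1 hk⟩
  have h4 : ∀ S : Finset K, P (⋂ k ∈ S, {w | 1 ≤ t i k w ∧ 1 ≤ t j k w})
      = ∏ k ∈ S, P {w | 1 ≤ t i k w} * P {w | 1 ≤ t j k w} := by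
    intro S
    rw [h3, h2, Finset.prod_product]
    refine Finset.prod_congr rfl fun k _ => ?_
    simp [E, v]
  have h5 : ∀ k : K, P {w | 1 ≤ t i k w ∧ 1 ≤ t j k w} =
      P {w | 1 ≤ t i k w} * P {w | 1 ≤ t j k w} := fun k => by
    simpa using h4 {k}
  have hS : ∀ k : K, MeasurableSet {w | 1 ≤ t i k w ∧ 1 ≤ t j k w} := fun k =>
    (hM.measurableSet_compared i k).inter (hM.measurableSet_compared j k)
  refine ⟨(iIndepSet_iff_meas_biInter hS).2 fun S => ?_, h5⟩
  rw [h4]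
  exact Finset.prod_congr rfl fun k _ => (h5 k).symm

variable [IsProbabilityMeasure P]

lemma le_trials (hM : IsModel P F β T p t a) {i j : Fin (n + 1)} (hij : i < j) :
    ∀ᵐ w ∂P, t i j w ≤ T := by
  have h : ∀ᵐ w ∂P, ∀ m k : ℕ, T < m → ¬ (t i j w = m ∧ a i j w = k) := by
    rw [ae_all_iff]; intro m
    rw [ae_all_iff]; intro k
    by_cases hm : T < m
    · have h0 := hM.law i j hij m k
      rw [binomialWeight, Nat.choose_eq_zero_of_lt hm, Nat.cast_zero, zero_mul, zero_mul,
        zero_mul, measureReal_eq_zero_iff] at h0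
      filter_upwards [measure_eq_zero_iff_ae_notMem.1 h0] with w hw _ using hw
    · exact Eventually.of_forall fun w h => absurd h hm
  filter_upwards [h] with w hw
  by_contra hcon
  exact hw _ _ (not_le.1 hcon) ⟨rfl, rfl⟩

lemma ae_le_trials (hM : IsModel P F β T p t a) (i j : Fin (n + 1)) :
    ∀ᵐ w ∂P, t i j w ≤ T := by
  rcases lt_trichotomy i j with h | rfl | h
  · exact hM.le_trials h
  · exact Eventually.of_forall fun w => by rw [hM.t_diag]; exact Nat.zero_le _
  · filter_upwards [hM.le_trials h] with w hw
    rwa [hM.t_symm]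

lemma integral_comp (hM : IsModel P F β T p t a) {i j : Fin (n + 1)} (hij : i < j)
    (g : ℕ → ℕ → ℝ) :
    ∫ w, g (t i j w) (a i j w) ∂P = ∑ m ∈ Finset.range (T + 1), ∑ k ∈ Finset.range (m + 1),
      binomialWeight T p m * binomialWeight m (F (β i - β j)) k * g m k := by
  have hms : ∀ m k : ℕ, MeasurableSet {w | t i j w = m ∧ a i j w = k} := fun m k =>
    (hM.measurable_t i j (measurableSet_singleton m)).inter
      (hM.measurable_a i j (measurableSet_singleton k))
  have h : (fun w => g (t i j w) (a i j w)) =ᵐ[P] fun w =>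
      ∑ m ∈ Finset.range (T + 1), ∑ k ∈ Finset.range (m + 1),
        {w | t i j w = m ∧ a i j w = k}.indicator (fun _ => g m k) w := by
    filter_upwards [hM.le_trials hij] with w hw
    have hk : a i j w ≤ t i j w := by rw [← hM.a_add i j w]; exact Nat.le_add_right _ _
    rw [Finset.sum_eq_single (t i j w), Finset.sum_eq_single (a i j w)]
    · simp
    · intro k _ hk
      simp [hk.symm]
    · intro h
      exact absurd (Finset.mem_range.2 (by omega)) h
    · intro m _ hm
      exact Finset.sum_eq_zero fun k _ => by simp [hm.symm]
    · intro h
      exact absurd (Finset.mem_range.2 (by omega)) h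
  have hint : ∀ m k : ℕ,
      Integrable ({w | t i j w = m ∧ a i j w = k}.indicator (fun _ => g m k)) P :=
    fun m k => (integrable_const _).indicator (hms m k)
  rw [integral_congr_ae h, integral_finsetSum _ fun m _ => integrable_finsetSum _ fun k _ =>
    hint m k]
  refine Finset.sum_congr rfl fun m _ => ?_
  rw [integral_finsetSum _ fun k _ => hint m k]
  refine Finset.sum_congr rfl fun k _ => ?_
  rw [integral_indicator_const _ (hms m k), hM.law i j hij, smul_eq_mul]

lemma integral_residual_of_lt (hM : IsModel P F β T p t a) {i j : Fin (n + 1)} (hij : i < j) :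
    ∫ w, ((a i j w : ℝ) - t i j w * F (β i - β j)) ∂P = 0 := by
  rw [hM.integral_comp hij (fun m k => (k : ℝ) - m * F (β i - β j))]
  refine Finset.sum_eq_zero fun m _ => ?_
  have h1 := sum_binomialWeight m (F (β i - β j))
  have h2 := sum_mul_binomialWeight m (F (β i - β j))
  simp only [mul_assoc, ← Finset.mul_sum]
  have : ∑ k ∈ Finset.range (m + 1), binomialWeight m (F (β i - β j)) k *
      ((k : ℝ) - m * F (β i - β j)) = 0 := by
    simp only [mul_sub, Finset.sum_sub_distrib, ← Finset.sum_mul, h1]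
    simp only [mul_comm _ ((_ : ℕ) : ℝ)] at h2 ⊢
    linarith
  rw [this, mul_zero]

lemma integral_residual (hM : IsModel P F β T p t a) (hF : ∀ x, F x = 1 - F (-x))
    {i j : Fin (n + 1)} (hij : i ≠ j) :
    ∫ w, ((a i j w : ℝ) - t i j w * F (β i - β j)) ∂P = 0 := by
  rcases lt_or_gt_of_ne hij with h | h
  · exact hM.integral_residual_of_lt h
  · have h1 := fun w => (hM.isTally w).residual_term_antisymm hF β i j
    simp only [h1]
    rw [integral_neg, hM.integral_residual_of_lt h, neg_zero]

/-- The n summands of a row are independent, centred and a.s. in [-T, T], so the variance proxy is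
nT²; the factor 2 accounts for both tails. -/
lemma hoeffding_residual (hM : IsModel P F β T p t a) (hF : ∀ x, F x = 1 - F (-x))
    (hF0 : ∀ x, 0 ≤ F x) (hF1 : ∀ x, F x ≤ 1) (i : Fin (n + 1)) {s : ℝ} (hs : 0 ≤ s) :
    P.real {w | s ≤ |residual F (fun i j => t i j w) (fun i j => a i j w) β i|}
      ≤ 2 * Real.exp (-s ^ 2 / (2 * (n * (T : ℝ) ^ 2))) := by
  let X : {j // j ≠ i} → Ω → ℝ := fun j w => (a i j w : ℝ) - t i j w * F (β i - β j)
  have hX : ∀ w, residual F (fun i j => t i j w) (fun i j => a i j w) β i = ∑ j, X j w := by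
    intro w
    simp only [residual]
    rw [Fintype.sum_eq_add_sum_subtype_ne _ i]
    simp [hM.a_diag, hM.t_diag, X]
  have hind : iIndepFun X P := (hM.iIndepFun_row i).comp (γ := fun _ => ℝ)
    (fun j x => (x.2 : ℝ) - x.1 * F (β i - β j)) (fun j => measurable_of_countable _)
  have hsub : ∀ j, HasSubgaussianMGF (X j) ((‖(T : ℝ) - -T‖₊ / 2) ^ 2) P := by
    intro j
    refine hasSubgaussianMGF_of_mem_Icc_of_integral_eq_zero ?_ ?_
      (hM.integral_residual hF j.2.symm)
    · have h1 : Measurable (fun w => (a i j w : ℝ)) :=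
        (measurable_of_countable (fun k : ℕ => (k : ℝ))).comp (hM.measurable_a i j)
      have h2 : Measurable (fun w => (t i j w : ℝ)) :=
        (measurable_of_countable (fun k : ℕ => (k : ℝ))).comp (hM.measurable_t i j)
      exact (h1.sub (h2.mul_const _)).aemeasurable
    · filter_upwards [hM.ae_le_trials i j] with w hw
      have h1 : (t i j w : ℝ) ≤ T := by exact_mod_cast hw
      have h2 : (a i j w : ℝ) + a j i w = t i j w := by exact_mod_cast hM.a_add i j w
      have h3 : (0 : ℝ) ≤ a i j w := Nat.cast_nonneg _
      have h4 : (0 : ℝ) ≤ a j i w := Nat.cast_nonneg _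
      have h5 : 0 ≤ (t i j w : ℝ) * F (β i - β j) := mul_nonneg (Nat.cast_nonneg _) (hF0 _)
      have h6 : (t i j w : ℝ) * F (β i - β j) ≤ t i j w :=
        mul_le_of_le_one_right (Nat.cast_nonneg _) (hF1 _)
      constructor <;> simp only [X] <;> linarith
  have hc : ∑ _j : {j // j ≠ i}, (((‖(T : ℝ) - -T‖₊ / 2) ^ 2 : NNReal) : ℝ) = n * (T : ℝ) ^ 2 := by
    rw [Finset.sum_const, nsmul_eq_mul]
    congr 1
    · simp [Fintype.card_subtype_compl]
    · simp only [NNReal.coe_pow, NNReal.coe_div, coe_nnnorm, Real.norm_eq_abs, NNReal.coe_ofNat]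
      rw [sub_neg_eq_add, abs_of_nonneg (by positivity)]
      ring
  have h1 := HasSubgaussianMGF.measure_sum_ge_le_of_iIndepFun hind (s := Finset.univ)
    (fun j _ => hsub j) hs
  have h2 := HasSubgaussianMGF.measure_sum_ge_le_of_iIndepFun (X := fun j w => -X j w)
    (hind.comp (γ := fun _ => ℝ) (fun _ x => -x) (fun _ => measurable_neg)) (s := Finset.univ)
    (fun j _ => (hsub j).neg) hs
  push_cast at h1 h2
  push_cast at hc
  rw [hc] at h1 h2
  have h3 : {w | s ≤ |residual F (fun i j => t i j w) (fun i j => a i j w) β i|}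
      ⊆ {w | s ≤ ∑ j, X j w} ∪ {w | s ≤ ∑ j, -X j w} := by
    intro w hw
    simp only [Set.mem_ofPred_eq, hX, le_abs] at hw
    simpa only [Set.mem_union, Set.mem_ofPred_eq, Finset.sum_neg_distrib] using hw
  calc _ ≤ P.real ({w | s ≤ ∑ j, X j w} ∪ {w | s ≤ ∑ j, -X j w}) := measureReal_mono h3
    _ ≤ _ := measureReal_union_le _ _
    _ ≤ _ := by linarith

lemma prob_compared (hM : IsModel P F β T p t a) (hT : 1 ≤ T) (hp0 : 0 < p) (hp1 : p ≤ 1)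
    {i j : Fin (n + 1)} (hij : i ≠ j) : p ≤ P.real {w | 1 ≤ t i j w} := by
  wlog h : i < j generalizing i j
  · have := this hij.symm (lt_of_le_of_ne (not_lt.1 h) hij.symm)
    simpa only [hM.t_symm i j] using this
  -- No comparison forces no win, so this is the event t = 0, of probability (1 - p)^T ≤ 1 - p.
  have h1 := hM.law i j h 0 0
  have h2 : {w | t i j w = 0 ∧ a i j w = 0} = {w | 1 ≤ t i j w}ᶜ := by
    ext w
    have := hM.a_add i j w
    simp only [Set.mem_ofPred_eq, Set.mem_compl_iff]
    omega
  rw [h2, probReal_compl_eq_one_sub (hM.measurableSet_compared i j)] at h1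
  have h3 : (1 - p) ^ T ≤ (1 - p) ^ 1 :=
    pow_le_pow_of_le_one (by linarith) (by linarith) hT
  simp [binomialWeight] at h1
  linarith

/-- Each of the n - 1 candidates is a common neighbour with probability at least p², and the event
is a deviation by half of that lower bound on the mean. -/
lemma hoeffding_common (hM : IsModel P F β T p t a) (hT : 1 ≤ T) (hp0 : 0 < p) (hp1 : p ≤ 1)
    (hn : 1 ≤ n) {i j : Fin (n + 1)} (hij : i ≠ j) :
    P.real {w | ((commonNeighbors (fun i j => t i j w) i j).card : ℝ) ≤ (n - 1) * p ^ 2 / 2}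
      ≤ Real.exp (-((n - 1) * p ^ 4 / 2)) := by
  let K := {k : Fin (n + 1) // k ≠ i ∧ k ≠ j}
  let S : K → Set Ω := fun k => {w | 1 ≤ t i k w ∧ 1 ≤ t j k w}
  let Y : K → Ω → ℝ := fun k => (S k).indicator 1
  have hS : ∀ k, MeasurableSet (S k) := fun k =>
    (hM.measurableSet_compared _ _).inter (hM.measurableSet_compared _ _)
  obtain ⟨hind, hmul⟩ := hM.iIndepSet_common hij
  have hcard : (Fintype.card K : ℝ) = n - 1 := by
    have h1 : Fintype.card K = (Finset.univ \ {i, j} : Finset (Fin (n + 1))).card := by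
      rw [Fintype.card_subtype]
      congr 1
      ext k
      simp
    rw [h1, Finset.card_sdiff_of_subset (Finset.subset_univ _), Finset.card_pair hij,
      Finset.card_univ, Fintype.card_fin, Nat.cast_sub (by omega)]
    push_cast
    ring
  have hY : iIndepFun Y P := hind.iIndepFun_indicator
  have hmean : ∀ k, p ^ 2 ≤ ∫ w, Y k w ∂P := by
    intro k
    have h1 : ∫ w, Y k w ∂P = P.real (S k) := integral_indicator_one (hS k)
    rw [h1, measureReal_def, hmul k, ENNReal.toReal_mul, sq]
    exact mul_le_mul (hM.prob_compared hT hp0 hp1 k.2.1.symm)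
      (hM.prob_compared hT hp0 hp1 k.2.2.symm) hp0.le measureReal_nonneg
  have hsub : ∀ k, HasSubgaussianMGF (fun w => -(Y k w - ∫ w, Y k w ∂P))
      ((‖(1 : ℝ) - 0‖₊ / 2) ^ 2) P := by
    intro k
    refine (hasSubgaussianMGF_of_mem_Icc
      ((measurable_const.indicator (hS k)).aemeasurable) (Eventually.of_forall fun w => ?_)).neg
    exact ⟨Set.indicator_nonneg (fun _ _ => zero_le_one) w,
      Set.indicator_le_self' (fun _ _ => zero_le_one) w⟩
  have hc : ∑ _k : K, (((‖(1 : ℝ) - 0‖₊ / 2) ^ 2 : NNReal) : ℝ) = (n - 1) / 4 := by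
    rw [Finset.sum_const, nsmul_eq_mul, Finset.card_univ, hcard]
    simp
    ring
  have hn' : (1 : ℝ) ≤ n := by exact_mod_cast hn
  have h1 := HasSubgaussianMGF.measure_sum_ge_le_of_iIndepFun
    (X := fun k w => -(Y k w - ∫ w, Y k w ∂P))
    (hY.comp (γ := fun _ => ℝ) (fun k x => -(x - ∫ w, Y k w ∂P)) (fun k => by fun_prop))
    (s := Finset.univ) (fun k _ => hsub k) (ε := (n - 1) * p ^ 2 / 2)
    (by have : (0 : ℝ) ≤ n - 1 := by linarith
        positivity)
  push_cast at h1 hc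
  rw [hc] at h1
  have hcn : ∀ w, ∑ k, Y k w ≤ (commonNeighbors (fun i j => t i j w) i j).card := by
    intro w
    have h2 : ∑ k, Y k w = ((Finset.univ.filter fun k : K => w ∈ S k).card : ℝ) := by
      rw [Finset.card_filter]
      push_cast
      refine Finset.sum_congr rfl fun k _ => ?_
      simp [Y, Set.indicator_apply]
    rw [h2, Nat.cast_le]
    refine Finset.card_le_card_of_injOn (fun k => k.1) (fun k hk => ?_)
      (fun k _ l _ h => Subtype.ext h)
    simpa [commonNeighbors, S] using hk
  refine (measureReal_mono fun w hw => ?_).trans (h1.trans (Real.exp_le_exp.2 ?_))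
  · simp only [Set.mem_ofPred_eq, Finset.sum_neg_distrib, Finset.sum_sub_distrib] at hw ⊢
    have h2 : (n - 1) * p ^ 2 ≤ ∑ k, ∫ w, Y k w ∂P := by
      have := Finset.sum_le_sum fun k (_ : k ∈ Finset.univ) => hmean k
      rwa [Finset.sum_const, nsmul_eq_mul, Finset.card_univ, hcard] at this
    linarith [hcn w]
  -- For n = 1 there are no candidates, and the quotient in the exponent is 0/0 = 0.
  · rcases hn'.eq_or_lt with h2 | h2
    · simp [← h2]
    · have h3 : (n : ℝ) - 1 ≠ 0 := by linarith
      apply le_of_eq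
      field_simp
      ring

end IsModel

end Probability

end PairedComparison

namespace PairedComparison

/-! ### Consequences of the derivative bounds near the true merits. -/

section Neighborhood

variable {n : ℕ} {F : ℝ → ℝ} {β : Fin (n + 1) → ℝ} {ε b0 b1 b2 : ℝ}

/-- Every number within `ε` of `β i - β j` is a difference of merits in the `ε`-neighbourhood. -/
lemma exists_perturbation (hβ : β 0 = 0) (hε : 0 ≤ ε) {i j : Fin (n + 1)} (hij : i ≠ j) {x : ℝ}
    (hx : |x - (β i - β j)| ≤ ε) :
    ∃ b : Fin (n + 1) → ℝ, b 0 = 0 ∧ (∀ k, |b k - β k| ≤ ε) ∧ b i - b j = x := by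
  -- One coordinate is moved, never the pinned coordinate 0.
  by_cases hi : i = 0
  · have hj : j ≠ 0 := by rintro rfl; exact hij hi
    refine ⟨Function.update β j (β i - x), ?_, fun k => ?_, ?_⟩
    · rw [Function.update_of_ne hj.symm, hβ]
    · by_cases hk : k = j
      · subst hk
        rw [Function.update_self, abs_sub_comm]
        convert hx using 2
        ring
      · rw [Function.update_of_ne hk, sub_self, abs_zero]
        exact hε
    · rw [Function.update_self, Function.update_of_ne hij]
      ring
  · refine ⟨Function.update β i (β j + x), ?_, fun k => ?_, ?_⟩
    · rw [Function.update_of_ne (Ne.symm hi), hβ]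
    · by_cases hk : k = i
      · subst hk
        rw [Function.update_self]
        convert hx using 2
        ring
      · rw [Function.update_of_ne hk, sub_self, abs_zero]
        exact hε
    · rw [Function.update_self, Function.update_of_ne hij.symm]
      ring

lemma DerivBounds.le_deriv (hB : DerivBounds F β ε b0 b1 b2) (hmono : Monotone F)
    (hβ : β 0 = 0) (hε : 0 ≤ ε) {i j : Fin (n + 1)} (hij : i ≠ j) {x : ℝ}
    (hx : |x - (β i - β j)| ≤ ε) : b0 ≤ deriv F x := by
  obtain ⟨b, h0, hb, rfl⟩ := exists_perturbation hβ hε hij hx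
  have := (hB.first b h0 hb i j hij).1
  rwa [abs_of_nonneg hmono.deriv_nonneg] at this

lemma DerivBounds.abs_deriv2_le (hB : DerivBounds F β ε b0 b1 b2)
    (hβ : β 0 = 0) (hε : 0 ≤ ε) {i j : Fin (n + 1)} (hij : i ≠ j) {x : ℝ}
    (hx : |x - (β i - β j)| ≤ ε) : |deriv (deriv F) x| ≤ b2 := by
  obtain ⟨b, h0, hb, rfl⟩ := exists_perturbation hβ hε hij hx
  exact hB.second b h0 hb i j hij

lemma DerivBounds.lower_le_upper (hB : DerivBounds F β ε b0 b1 b2) (hβ : β 0 = 0) (hε : 0 ≤ ε)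
    (hn : 1 ≤ n) : b0 ≤ b1 := by
  have h := hB.first β hβ (fun i => by simpa using hε) 0 (Fin.last n)
    (by rw [Ne, Fin.ext_iff]; simp; omega)
  exact h.1.trans h.2

/-- The mean value inequality is used up to distance min u ε, monotonicity beyond. -/
lemma DerivBounds.growsAt (hB : DerivBounds F β ε b0 b1 b2) (hmono : Monotone F)
    (hd : Differentiable ℝ F) (hβ : β 0 = 0) (hε : 0 ≤ ε) : GrowsAt F β ε b0 := by
  intro i j hij u hu
  have h1 : F (β i - β j + min u ε) ≤ F (β i - β j + u) :=
    hmono (by linarith [min_le_left u ε])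
  have h2 := (convex_Icc (β i - β j) (β i - β j + ε)).mul_sub_le_image_sub_of_le_deriv
    hd.continuous.continuousOn hd.differentiableOn (C := b0) (fun x hx => by
      rw [interior_Icc] at hx
      exact hB.le_deriv hmono hβ hε hij (abs_le.2 ⟨by linarith [hx.1], by linarith [hx.2]⟩))
    (β i - β j) ⟨le_rfl, by linarith⟩ (β i - β j + min u ε)
    ⟨by linarith [le_min hu hε], by linarith [min_le_right u ε]⟩ (by linarith [le_min hu hε])
  rw [add_sub_cancel_left] at h2
  linarith

/-- If the total increase of the distribution function near all `β i` would exceed one, then two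
merits are close to each other. -/
lemma GrowsAt.exists_close {ν : Measure ℝ} [IsProbabilityMeasure ν]
    (hg : GrowsAt (cdf ν) β ε b0) (hε : 0 ≤ ε) (hn : 4 < n * (b0 * ε)) :
    ∃ i j, i ≠ j ∧ |β i - β j| ≤ ε / 2 := by
  by_contra! hcon
  -- These n intervals have mass at least b0·ε/4 each; were they disjoint, the total would exceed 1.
  let I : {i : Fin (n + 1) // i ≠ 0} → Set ℝ :=
    fun i => Set.Ioc (β i - β 0) (β i - β 0 + ε / 4)
  have hI : ∀ i, b0 * (ε / 4) ≤ ν.real (I i) := by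
    intro i
    have h1 := hg i 0 i.2 (ε / 4) (by positivity)
    rw [min_eq_left (by linarith)] at h1
    have h2 : ν.real (I i) = cdf ν (β i - β 0 + ε / 4) - cdf ν (β i - β 0) := by
      rw [cdf_eq_real, cdf_eq_real, ← measureReal_sdiff (Set.Iic_subset_Iic.2 (by linarith))
        measurableSet_Iic, Set.Iic_sdiff_Iic]
    rwa [h2]
  have hdis : Pairwise (Function.onFun Disjoint I) := by
    intro i j hij
    refine Set.disjoint_left.2 fun x hx hy => ?_
    have h1 := hcon i j (fun h => hij (Subtype.ext h))
    have h2 : |β i - β j| ≤ ε / 4 :=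
      abs_le.2 ⟨by linarith [hx.1, hx.2, hy.1, hy.2], by linarith [hx.1, hx.2, hy.1, hy.2]⟩
    linarith
  have h1 : ∑ i, ν.real (I i) ≤ 1 := by
    rw [← measureReal_iUnion_fintype hdis (fun i => measurableSet_Ioc)]
    exact measureReal_le_one
  have h2 := (Finset.sum_le_sum fun i (_ : i ∈ Finset.univ) => hI i).trans h1
  rw [Finset.sum_const, nsmul_eq_mul, Finset.card_univ, Fintype.card_subtype_compl] at h2
  simp at h2
  linarith

end Neighborhood

/-- A twice differentiable distribution function on the line is not affine. -/
lemma exists_deriv2_cdf_ne_zero (ν : Measure ℝ) [IsProbabilityMeasure ν]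
    (hd1 : Differentiable ℝ (cdf ν)) (hd2 : Differentiable ℝ (deriv (cdf ν))) :
    ∃ x, deriv (deriv (cdf ν)) x ≠ 0 := by
  by_contra! h
  have h1 : ∀ x, deriv (cdf ν) x = deriv (cdf ν) 0 := fun x => is_const_of_deriv_eq_zero hd2 h x 0
  set c := deriv (cdf ν) 0 with hc
  have h2 : ∀ x, cdf ν x = cdf ν 0 + c * x := by
    intro x
    have h3 := is_const_of_deriv_eq_zero (f := fun x => cdf ν x - c * x) (by fun_prop)
      (fun x => by
        rw [deriv_fun_sub (hd1 x) (by fun_prop), h1, deriv_const_mul_field, deriv_id'']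
        ring) x 0
    simp only [mul_zero, sub_zero] at h3
    linarith
  -- A bounded affine function is constant, which the limits 0 and 1 exclude.
  have hc0 : c = 0 := by
    by_contra hc0
    have h3 := h2 (2 / c)
    rw [mul_div_cancel₀ _ hc0] at h3
    linarith [cdf_nonneg ν 0, cdf_le_one ν (2 / c)]
  have h3 : ∀ x, cdf ν x = cdf ν 0 := fun x => by rw [h2 x, hc0]; ring
  have h4 := tendsto_cdf_atTop ν
  have h5 := tendsto_cdf_atBot ν
  rw [show ((cdf ν : ℝ → ℝ)) = fun _ => cdf ν 0 from funext h3, tendsto_const_nhds_iff] at h4 h5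
  linarith

/-! ### Asymptotics of the rate and of the edge density. -/

section Rate

/-- The maximum principle yields √(log n/n)/(b0 p²); the stated rate is larger by the factor
(b1/b0)² ≥ 1. -/
lemma le_rate {b0 b1 p : ℕ → ℝ} {n : ℕ} (h0 : 0 < b0 n) (h01 : b0 n ≤ b1 n) (hp : 0 < p n) :
    √(Real.log n / n) ≤ b0 n * p n ^ 2 * rate b0 b1 p n := by
  have h1 : b0 n * p n ^ 2 * rate b0 b1 p n = (b1 n / b0 n) ^ 2 * √(Real.log n / n) := by
    unfold rate
    field_simp
  rw [h1]
  refine le_mul_of_one_le_left (Real.sqrt_nonneg _) (one_le_pow₀ ?_)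
  rwa [one_le_div h0]

lemma natCast_mul_sqrt_log_div {n : ℕ} (hn : 1 ≤ n) :
    n * √(Real.log n / n) = √(n * Real.log n) := by
  have h : (0 : ℝ) < n := by exact_mod_cast hn
  rw [show (n : ℝ) * Real.log n = n ^ 2 * (Real.log n / n) by field_simp,
    Real.sqrt_mul (by positivity), Real.sqrt_sq h.le]

lemma rate_nonneg {b0 b1 p : ℕ → ℝ} {n : ℕ} (h0 : 0 < b0 n) : 0 ≤ rate b0 b1 p n := by
  unfold rate
  positivity

variable {ν : Measure ℝ} [IsProbabilityMeasure ν] {p : ℕ → ℝ}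
  {βs : ∀ n : ℕ, Fin (n + 1) → ℝ} {ε b0 b1 b2 : ℕ → ℝ}

/-- Eventually two merits are close compared with the size of the neighbourhood. -/
lemma eventually_exists_close (hd1 : Differentiable ℝ (cdf ν))
    (hp : ∀ n, 0 < p n ∧ p n ≤ 1) (hβs : ∀ n, βs n 0 = 0)
    (hpos : ∀ n, 0 < ε n ∧ 0 < b0 n ∧ 0 < b1 n ∧ 0 < b2 n)
    (hbounds : ∀ n, DerivBounds (cdf ν) (βs n) (ε n) (b0 n) (b1 n) (b2 n))
    (hε : rate b0 b1 p =o[atTop] ε) :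
    ∀ᶠ n in atTop, ∃ i j, i ≠ j ∧ |βs n i - βs n j| ≤ ε n / 2 := by
  have h1 : Tendsto (fun n : ℕ => √(n * Real.log n)) atTop atTop :=
    Real.tendsto_sqrt_atTop.comp (tendsto_natCast_atTop_atTop.atTop_mul_atTop₀
      (Real.tendsto_log_atTop.comp tendsto_natCast_atTop_atTop))
  filter_upwards [h1.eventually_gt_atTop 4, hε.bound one_pos, eventually_ge_atTop 1]
    with n h4 hr hn
  obtain ⟨e0, p0, -, -⟩ := hpos n
  -- Here n·b0·ε ≥ n·b0·p²·rate ≥ √(n log n) > 4.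
  refine ((hbounds n).growsAt (monotone_cdf ν) hd1 (hβs n) e0.le).exists_close e0.le
    (h4.trans_le ?_)
  rw [one_mul, Real.norm_of_nonneg (rate_nonneg p0), Real.norm_of_nonneg e0.le] at hr
  rw [← natCast_mul_sqrt_log_div hn]
  have h5 := le_rate (b1 := b1) (p := p) p0
    ((hbounds n).lower_le_upper (hβs n) e0.le hn) (hp n).1
  have h6 : p n ^ 2 ≤ 1 := pow_le_one₀ (hp n).1.le (hp n).2
  refine mul_le_mul_of_nonneg_left (h5.trans ?_) (Nat.cast_nonneg n)
  exact mul_le_mul (mul_le_of_le_one_right p0.le h6) hr (rate_nonneg p0) p0.le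

/-- Where ε is below a fixed constant, rate = o(ε) suffices. Where it is above, b2 is at least
|F''(x)| > 0 for a fixed x, and the growth condition controls rate². -/
lemma tendsto_rate (hd1 : Differentiable ℝ (cdf ν)) (hd2 : Differentiable ℝ (deriv (cdf ν)))
    (hp : ∀ n, 0 < p n ∧ p n ≤ 1) (hβs : ∀ n, βs n 0 = 0)
    (hpos : ∀ n, 0 < ε n ∧ 0 < b0 n ∧ 0 < b1 n ∧ 0 < b2 n)
    (hbounds : ∀ n, DerivBounds (cdf ν) (βs n) (ε n) (b0 n) (b1 n) (b2 n))
    (hε : rate b0 b1 p =o[atTop] ε)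
    (hgrowth : (fun n => b1 n ^ 4 * b2 n / (b0 n ^ 6 * p n ^ 4)) =o[atTop]
      (fun n : ℕ => √((n : ℝ) / Real.log n))) :
    Tendsto (rate b0 b1 p) atTop (𝓝 0) := by
  obtain ⟨x, hx⟩ := exists_deriv2_cdf_ne_zero ν hd1 hd2
  have hc := abs_pos.2 hx
  set c := |deriv (deriv (cdf ν)) x|
  rw [Metric.tendsto_atTop']
  suffices h : ∀ δ > 0, ∀ᶠ n in atTop, rate b0 b1 p n ≤ δ by
    intro δ hδ
    obtain ⟨N, hN⟩ := eventually_atTop.1 (h (δ / 2) (by positivity))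
    refine ⟨N, fun n hn => ?_⟩
    rw [Real.dist_0_eq_abs, abs_of_nonneg (rate_nonneg (hpos n).2.1)]
    linarith [hN n hn.le]
  intro δ hδ
  -- For ε above this constant |x| + ε/2 ≤ ε, so x is within ε of the difference of two close
  -- merits.
  have hK : 0 < 2 * |x| + 1 := by positivity
  filter_upwards [eventually_exists_close hd1 hp hβs hpos hbounds hε,
    hε.bound (show 0 < δ / (2 * |x| + 1) by positivity),
    hgrowth.bound (show 0 < c * δ ^ 2 by positivity), eventually_ge_atTop 2]
    with n ⟨i, j, hij, hclose⟩ hr hg hn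
  obtain ⟨e0, p0, p1, p2⟩ := hpos n
  have hpn := (hp n).1
  rw [Real.norm_of_nonneg (rate_nonneg p0), Real.norm_of_nonneg e0.le] at hr
  rcases le_or_gt (ε n) (2 * |x| + 1) with h | h
  · refine hr.trans ?_
    rw [div_mul_eq_mul_div, div_le_iff₀ hK]
    exact mul_le_mul_of_nonneg_left h hδ.le
  · have hb2 : c ≤ b2 n := (hbounds n).abs_deriv2_le (hβs n) e0.le hij
      ((abs_sub _ _).trans (by linarith))
    have hn2 : (2 : ℝ) ≤ n := by exact_mod_cast hn
    have hlog : 0 < Real.log n := Real.log_pos (by linarith)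
    set q := Real.log n / n with hq
    have hq0 : 0 < q := by positivity
    have hq1 : q ≤ 1 := by
      rw [hq, div_le_one (by linarith)]
      linarith [Real.log_le_sub_one_of_pos (show (0 : ℝ) < n by linarith)]
    have hqi : √((n : ℝ) / Real.log n) = (√q)⁻¹ := by
      rw [← Real.sqrt_inv, hq, inv_div]
    rw [Real.norm_of_nonneg (by positivity), Real.norm_of_nonneg (by positivity), hqi] at hg
    have hs : 0 < √q := Real.sqrt_pos.2 hq0
    have hs1 : √q ≤ 1 := Real.sqrt_le_one.2 hq1
    refine le_of_sq_le_sq ?_ hδ.le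
    have h1 : rate b0 b1 p n ^ 2 * c ≤ b1 n ^ 4 * b2 n / (b0 n ^ 6 * p n ^ 4) * √q ^ 2 := by
      have : rate b0 b1 p n ^ 2 * c = b1 n ^ 4 * c / (b0 n ^ 6 * p n ^ 4) * √q ^ 2 := by
        unfold rate
        rw [← hq]
        field_simp
      rw [this]
      gcongr
    have h2 := mul_le_mul_of_nonneg_right hg (sq_nonneg √q)
    have h3 : c * δ ^ 2 * (√q)⁻¹ * √q ^ 2 = c * δ ^ 2 * √q := by
      field_simp
    have h4 : c * δ ^ 2 * √q ≤ c * δ ^ 2 := mul_le_of_le_one_right (by positivity) hs1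
    rw [h3] at h2
    have h5 : rate b0 b1 p n ^ 2 * c ≤ δ ^ 2 * c := by linarith
    exact le_of_mul_le_mul_right h5 hc

/-- The comparison graph is eventually dense enough for the common neighbour counts to
concentrate. -/
lemma eventually_log_le (hd1 : Differentiable ℝ (cdf ν)) (hd2 : Differentiable ℝ (deriv (cdf ν)))
    (hp : ∀ n, 0 < p n ∧ p n ≤ 1) (hβs : ∀ n, βs n 0 = 0)
    (hpos : ∀ n, 0 < ε n ∧ 0 < b0 n ∧ 0 < b1 n ∧ 0 < b2 n)
    (hbounds : ∀ n, DerivBounds (cdf ν) (βs n) (ε n) (b0 n) (b1 n) (b2 n))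
    (hε : rate b0 b1 p =o[atTop] ε)
    (hgrowth : (fun n => b1 n ^ 4 * b2 n / (b0 n ^ 6 * p n ^ 4)) =o[atTop]
      (fun n : ℕ => √((n : ℝ) / Real.log n))) :
    ∀ᶠ n : ℕ in atTop, Real.log n ≤ n * p n ^ 4 / 16 := by
  have hm0 : 0 ≤ deriv (cdf ν) 0 := (monotone_cdf ν).deriv_nonneg
  -- The point 0 is within ε of a difference of close merits, so b0 ≤ F'(0); adding 1 makes m
  -- positive.
  set m := deriv (cdf ν) 0 + 1 with hm
  have hm1 : 0 < m := by linarith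
  filter_upwards [eventually_exists_close hd1 hp hβs hpos hbounds hε,
    (tendsto_rate hd1 hd2 hp hβs hpos hbounds hε hgrowth).eventually_lt_const
      (show 0 < 1 / (4 * m) by positivity), eventually_ge_atTop 1] with n ⟨i, j, hij, hc⟩ hr hn
  obtain ⟨e0, p0, -, -⟩ := hpos n
  have hpn := (hp n).1
  have hb0 : b0 n ≤ m := by
    have := (hbounds n).le_deriv (monotone_cdf ν) (hβs n) e0.le hij (x := 0) (by
      rw [zero_sub, abs_neg]; linarith)
    linarith
  have hn1 : (1 : ℝ) ≤ n := by exact_mod_cast hn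
  have h1 := le_rate (b1 := b1) (p := p) p0
    ((hbounds n).lower_le_upper (hβs n) e0.le hn) hpn
  have h2 : b0 n * p n ^ 2 * rate b0 b1 p n ≤ m * p n ^ 2 * (1 / (4 * m)) :=
    mul_le_mul (by gcongr) hr.le (rate_nonneg p0) (by positivity)
  have h3 : m * p n ^ 2 * (1 / (4 * m)) = p n ^ 2 / 4 := by field_simp
  rw [h3] at h2
  -- Square √(log n/n) ≤ p²/4.
  have h4 := (Real.sqrt_le_left (by positivity)).1 (h1.trans h2)
  rw [div_le_iff₀ (by linarith)] at h4
  linarith [h4]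

end Rate

/-! ### Probability of the good event. -/

section GoodEvent

variable {n : ℕ} {Ω : Type*} [MeasurableSpace Ω] {P : Measure Ω} [IsProbabilityMeasure P]
  {F : ℝ → ℝ} {β : Fin (n + 1) → ℝ} {T : ℕ} {p : ℝ} {t a : Fin (n + 1) → Fin (n + 1) → Ω → ℕ}

/-- The observed arrays have small residuals at `β` and many common neighbours. -/
def IsRegular (F : ℝ → ℝ) (β : Fin (n + 1) → ℝ) (T : ℕ) (p : ℝ)
    (t a : Fin (n + 1) → Fin (n + 1) → ℕ) : Prop :=
  (∀ i, |residual F t a β i| ≤ 2 * T * √(n * Real.log n)) ∧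
    ∀ i j, i ≠ j → n * p ^ 2 / 4 ≤ (commonNeighbors t i j).card

/-- The residual threshold gives failure probability 2/n² per row, the density assumption 1/n³ per
pair: enough for a union over n + 1 rows and (n + 1)² pairs. -/
lemma IsModel.prob_not_isRegular_le (hM : IsModel P F β T p t a) (hF : ∀ x, F x = 1 - F (-x))
    (hF0 : ∀ x, 0 ≤ F x) (hF1 : ∀ x, F x ≤ 1) (hT : 1 ≤ T) (hp0 : 0 < p) (hp1 : p ≤ 1)
    (hn : 2 ≤ n) (hlog : Real.log n ≤ n * p ^ 4 / 16) :
    P.real {w | ¬ IsRegular F β T p (fun i j => t i j w) (fun i j => a i j w)} ≤ 8 / n := by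
  have hn2 : (2 : ℝ) ≤ n := by exact_mod_cast hn
  have hn0 : (0 : ℝ) < n := by linarith
  have hl : 0 ≤ Real.log n := Real.log_nonneg (by linarith)
  have hT0 : (0 : ℝ) < T := by exact_mod_cast hT
  let A : Fin (n + 1) → Set Ω := fun i => {w | 2 * T * √(n * Real.log n) ≤
    |residual F (fun i j => t i j w) (fun i j => a i j w) β i|}
  let B : Fin (n + 1) × Fin (n + 1) → Set Ω := fun e => {w | e.1 ≠ e.2 ∧
    ((commonNeighbors (fun i j => t i j w) e.1 e.2).card : ℝ) ≤ (n - 1) * p ^ 2 / 2}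
  have hsub : {w | ¬ IsRegular F β T p (fun i j => t i j w) (fun i j => a i j w)}
      ⊆ (⋃ i, A i) ∪ ⋃ e, B e := by
    intro w hw
    by_contra hcon
    simp only [Set.mem_union, Set.mem_iUnion, not_or, not_exists] at hcon
    refine hw ⟨fun i => (not_le.1 (hcon.1 i)).le, fun i j hij => ?_⟩
    have h1 := hcon.2 (i, j)
    simp only [B, Set.mem_ofPred_eq, not_and, not_le] at h1
    -- This gives (n - 1)p²/2 ≥ np²/4.
    have h2 : (0 : ℝ) ≤ (n - 2) * p ^ 2 := mul_nonneg (by linarith) (sq_nonneg p)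
    linarith [h1 hij]
  have hexp : ∀ m : ℕ, Real.exp (-(m * Real.log n)) = 1 / (n : ℝ) ^ m := by
    intro m
    rw [Real.exp_neg, ← Real.log_pow, Real.exp_log (by positivity), one_div]
  have hA : ∀ i, P.real (A i) ≤ 2 * (1 / (n : ℝ) ^ 2) := by
    intro i
    refine (hM.hoeffding_residual hF hF0 hF1 i (by positivity)).trans (le_of_eq ?_)
    rw [← hexp 2, mul_pow, Real.sq_sqrt (by positivity)]
    congr 2
    push_cast
    field_simp
  have hB : ∀ e, P.real (B e) ≤ 1 / (n : ℝ) ^ 3 := by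
    intro e
    by_cases he : e.1 = e.2
    · have : B e = ∅ := by simp [B, he]
      rw [this, measureReal_empty]
      positivity
    · refine (measureReal_mono fun w hw => hw.2).trans
        ((hM.hoeffding_common hT hp0 hp1 (by omega) he).trans ?_)
      rw [← hexp 3, Real.exp_le_exp, neg_le_neg_iff]
      have : (0 : ℝ) ≤ (n - 2) * p ^ 4 := mul_nonneg (by linarith) (by positivity)
      push_cast
      linarith
  calc _ ≤ P.real ((⋃ i, A i) ∪ ⋃ e, B e) := measureReal_mono hsub
    _ ≤ P.real (⋃ i, A i) + P.real (⋃ e, B e) := measureReal_union_le _ _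
    _ ≤ ∑ i, P.real (A i) + ∑ e, P.real (B e) :=
      add_le_add (measureReal_iUnion_fintype_le _) (measureReal_iUnion_fintype_le _)
    _ ≤ ∑ _i : Fin (n + 1), 2 * (1 / (n : ℝ) ^ 2)
        + ∑ _e : Fin (n + 1) × Fin (n + 1), 1 / (n : ℝ) ^ 3 :=
      add_le_add (Finset.sum_le_sum fun i _ => hA i) (Finset.sum_le_sum fun e _ => hB e)
    _ = (n + 1) * (2 * (1 / (n : ℝ) ^ 2)) + (n + 1) * (n + 1) * (1 / (n : ℝ) ^ 3) := by
      simp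
    _ ≤ (2 * n) * (2 * (1 / (n : ℝ) ^ 2)) + (2 * n) * (2 * n) * (1 / (n : ℝ) ^ 3) := by
      gcongr <;> linarith
    _ = 8 / n := by field_simp; norm_num

end GoodEvent

end PairedComparison

/-! ### Assembly of the theorem. -/

theorem mainTheorem1
    -- the known symmetric, three times differentiable distribution function `F = cdf ν`
    (ν : Measure ℝ) [IsProbabilityMeasure ν]
    (hsymm : ∀ x, cdf ν x = 1 - cdf ν (-x))
    (hd1 : Differentiable ℝ (cdf ν)) (hd2 : Differentiable ℝ (deriv (cdf ν)))
    (hd3 : Differentiable ℝ (deriv (deriv (cdf ν))))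
    -- the design and the true merits
    (T : ℕ) (hT : 1 ≤ T)
    (p : ℕ → ℝ) (hp : ∀ n, 0 < p n ∧ p n ≤ 1)
    (βs : ∀ n : ℕ, Fin (n + 1) → ℝ) (hβs : ∀ n, βs n 0 = 0)
    -- the data
    {Ω : ℕ → Type*} [∀ n, MeasurableSpace (Ω n)]
    (P : ∀ n, Measure (Ω n)) [∀ n, IsProbabilityMeasure (P n)]
    (t a : ∀ n : ℕ, Fin (n + 1) → Fin (n + 1) → Ω n → ℕ)
    (hmodel : ∀ n, PairedComparison.IsModel (P n) (cdf ν) (βs n) T (p n) (t n) (a n))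
    -- the bounds on the derivatives near the true merits
    (ε b0 b1 b2 : ℕ → ℝ)
    (hpos : ∀ n, 0 < ε n ∧ 0 < b0 n ∧ 0 < b1 n ∧ 0 < b2 n)
    (hbounds : ∀ n, PairedComparison.DerivBounds (cdf ν) (βs n) (ε n) (b0 n) (b1 n) (b2 n))
    -- the neighbourhood is large compared with the rate
    (hε : PairedComparison.rate b0 b1 p =o[atTop] ε)
    -- the growth condition
    (hgrowth : (fun n => b1 n ^ 4 * b2 n / (b0 n ^ 6 * p n ^ 4)) =o[atTop]
      (fun n : ℕ => √((n : ℝ) / Real.log n))) :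
    Tendsto (fun n => (P n).real {w | ∃ b : Fin (n + 1) → ℝ,
      PairedComparison.IsMomentEstimator (cdf ν)
        (fun i j => t n i j w) (fun i j => a n i j w) b}) atTop (𝓝 1) ∧
    ∀ βhat : ∀ n : ℕ, Ω n → Fin (n + 1) → ℝ,
      (∀ n w, (∃ b : Fin (n + 1) → ℝ, PairedComparison.IsMomentEstimator (cdf ν)
          (fun i j => t n i j w) (fun i j => a n i j w) b) →
        PairedComparison.IsMomentEstimator (cdf ν)
          (fun i j => t n i j w) (fun i j => a n i j w) (βhat n w)) →
      PairedComparison.IsBigOp P (fun n w => ‖βhat n w - βs n‖)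
        (PairedComparison.rate b0 b1 p) ∧
      PairedComparison.IsLittleOpOne P (fun n w => ‖βhat n w - βs n‖) := by
  have hF0 := cdf_nonneg ν
  have hF1 := cdf_le_one ν
  have hT0 : (0 : ℝ) < T := by exact_mod_cast hT
  have hrate := PairedComparison.tendsto_rate hd1 hd2 hp hβs hpos hbounds hε hgrowth
  let bad : ∀ n, Set (Ω n) := fun n => {w | ¬ PairedComparison.IsRegular (cdf ν) (βs n) T (p n)
    (fun i j => t n i j w) (fun i j => a n i j w)}
  have hbad : ∀ᶠ n in atTop, (P n).real (bad n) ≤ 8 / n := by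
    filter_upwards [PairedComparison.eventually_log_le hd1 hd2 hp hβs hpos hbounds hε hgrowth,
      eventually_ge_atTop 2] with n hlog hn
    exact (hmodel n).prob_not_isRegular_le hsymm hF0 hF1 hT (hp n).1 (hp n).2 hn hlog
  have hlim : Tendsto (fun n : ℕ => (8 : ℝ) / n) atTop (𝓝 0) :=
    tendsto_const_div_atTop_nhds_zero_nat 8
  have hΦ : ∀ x, HasDerivAt (fun y => ∫ s in (0 : ℝ)..y, cdf ν s) (cdf ν x) x := fun x =>
    (hd1.continuous.integral_hasStrictDerivAt 0 x).hasDerivAt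
  have hgood : ∀ᶠ n in atTop, ∀ w ∉ bad n,
      (∃ b : Fin (n + 1) → ℝ, PairedComparison.IsMomentEstimator (cdf ν)
        (fun i j => t n i j w) (fun i j => a n i j w) b) ∧
      ∀ b : Fin (n + 1) → ℝ, PairedComparison.IsMomentEstimator (cdf ν)
        (fun i j => t n i j w) (fun i j => a n i j w) b →
        ‖b - βs n‖ ≤ 16 * T * PairedComparison.rate b0 b1 p n := by
    -- The constant makes the radius 16T·rate at most ε/2, hence strictly smaller than ε.
    filter_upwards [hε.bound (show 0 < 1 / (32 * (T : ℝ)) by positivity), eventually_ge_atTop 2]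
      with n hr hn w hw
    obtain ⟨e0, p0, -, -⟩ := hpos n
    have hpn := (hp n).1
    have hn0 : (0 : ℝ) < n := by exact_mod_cast (by omega : 0 < n)
    have hr0 : 0 ≤ PairedComparison.rate b0 b1 p n := PairedComparison.rate_nonneg p0
    rw [Real.norm_of_nonneg hr0, Real.norm_of_nonneg e0.le, div_mul_eq_mul_div, one_mul,
      le_div_iff₀ (by positivity)] at hr
    have hR : 16 * T * PairedComparison.rate b0 b1 p n < ε n := by linarith
    have htally := (hmodel n).isTally w
    have hgrow := (hbounds n).growsAt (monotone_cdf ν) hd1 (hβs n) e0.le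
    obtain ⟨hres, hcard⟩ := not_not.1 hw
    have hcard0 : ∀ i k, i ≠ k → (0 : ℝ) <
        (PairedComparison.commonNeighbors (fun i j => t n i j w) i k).card := fun i k hik =>
      lt_of_lt_of_le (by positivity) (hcard i k hik)
    have hH : ∀ i k, i ≠ k → 2 * (2 * T * √(n * Real.log n)) ≤
        b0 n * (16 * T * PairedComparison.rate b0 b1 p n) *
          (PairedComparison.commonNeighbors (fun i j => t n i j w) i k).card := by
      intro i k hik
      have h1 := PairedComparison.le_rate (b1 := b1) (p := p) p0
        ((hbounds n).lower_le_upper (hβs n) e0.le (by omega)) hpn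
      rw [← PairedComparison.natCast_mul_sqrt_log_div (by omega)]
      calc 2 * (2 * T * (n * √(Real.log n / n))) = 4 * T * n * √(Real.log n / n) := by ring
        _ ≤ 4 * T * n * (b0 n * p n ^ 2 * PairedComparison.rate b0 b1 p n) := by gcongr
        _ = b0 n * (16 * T * PairedComparison.rate b0 b1 p n) * (n * p n ^ 2 / 4) := by ring
        _ ≤ _ := mul_le_mul_of_nonneg_left (hcard i k hik) (by positivity)
    refine ⟨htally.exists_isMomentEstimator hsymm hΦ (hβs n) p0.le e0 hgrow hres
      fun i k hik => (hH i k hik).trans_lt ?_, fun b hb => hb.norm_sub_le htally hsymm (hβs n) p0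
      (by positivity) hR hgrow hres fun i k hik => ⟨by exact_mod_cast hcard0 i k hik, hH i k hik⟩⟩
    exact mul_lt_mul_of_pos_right (mul_lt_mul_of_pos_left hR p0) (hcard0 i k hik)
  refine ⟨?_, fun βhat hβhat => ?_⟩
  · refine tendsto_of_tendsto_of_tendsto_of_le_of_le'
      (by simpa using tendsto_const_nhds.sub hlim : Tendsto (fun n : ℕ => 1 - (8 : ℝ) / n) _ _)
      tendsto_const_nhds ?_ (Eventually.of_forall fun n => measureReal_le_one)
    filter_upwards [hbad, hgood] with n h1 h2
    -- Subadditivity replaces complementation, so no measurability of these events is needed.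
    have h3 : (1 : ℝ) ≤ (P n).real (bad n) + (P n).real {w | ∃ b : Fin (n + 1) → ℝ,
        PairedComparison.IsMomentEstimator (cdf ν)
          (fun i j => t n i j w) (fun i j => a n i j w) b} := by
      rw [← probReal_univ (μ := P n)]
      refine (measureReal_mono fun w _ => ?_).trans (measureReal_union_le _ _)
      by_cases hw : w ∈ bad n
      · exact Or.inl hw
      · exact Or.inr (h2 w hw).1
    linarith
  · have hdev : ∀ᶠ n in atTop, ∀ s, 16 * T * PairedComparison.rate b0 b1 p n ≤ s →
        (P n).real {w | s < |‖βhat n w - βs n‖|} ≤ 8 / n := by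
      filter_upwards [hbad, hgood] with n h1 h2 s hs
      refine (measureReal_mono fun w hw => ?_).trans h1
      by_contra hcon
      obtain ⟨h3, h4⟩ := h2 w hcon
      rw [Set.mem_ofPred_eq, abs_norm] at hw
      linarith [h4 _ (hβhat n w h3)]
    refine ⟨fun δ hδ => ⟨16 * T, by positivity, ?_⟩, fun δ hδ => ?_⟩
    · filter_upwards [hdev, hlim.eventually_le_const hδ] with n h1 h2
      exact (h1 _ le_rfl).trans h2
    · refine squeeze_zero' (Eventually.of_forall fun n => measureReal_nonneg) ?_ hlim
      have h0 : Tendsto (fun n => 16 * T * PairedComparison.rate b0 b1 p n) atTop (𝓝 0) := by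
        simpa using hrate.const_mul (16 * (T : ℝ))
      filter_upwards [hdev, h0.eventually_le_const hδ] with n h1 h2
      exact h1 _ h2
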